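/- Let $\mu$ be the Borel measure on $(0,1)$ given by $$d\mu(t)=\frac{dt}{t(1-t)\Big(\pi^2+\big(\log\frac{t}{1-t}\big)^2\Big)}.$$ Let $H$ be a real or complex Hilbert space, and call a bounded linear operator $A$ on $H$ positive invertible if it is self-adjoint, $\langle Ax,x\rangle\ge 0$ for all $x\in H$, and $A$ is invertible. For positive invertible operators $A,B$ on $H$ and $t\in[0,1]$ put $$A!_tB=\big((1-t)A^{-1}+tB^{-1}\big)^{-1},\qquad A\sharp_tB=A^{1/2}\big(A^{-1/2}BA^{-1/2}\big)^tA^{1/2},$$ where powers, and more generally $f(T)$ for $f$ continuous on the spectrum of a self-adjoint $T$, are taken in the continuous functional calculus. Define the operator logarithmic mean by $L(A,B)=\int_0^1A\sharp_tB\,dt$, and let $F(x)=\frac{x-1}{\log x}$ for $x>0$, $x\ne1$, and $F(1)=1$. All operator integrals are Bochner integrals in the operator norm. Then: 1. $\mu$ is a probability measure on $(0,1)$. 2. For all positive invertible operators $A,B$ on $H$, the functions $t\mapsto A\sharp_tB$ and $t\mapsto A!_tB$ are integrable on $(0,1)$ with respect to $dt$ and $d\mu(t)$ respectively, and $$L(A,B)=A^{1/2}F\big(A^{-1/2}BA^{-1/2}\big)A^{1/2}=\int_0^1A!_tB\,d\mu(t).$$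 3. $\mu$ is the Kubo–Ando representing measure of the logarithmic mean: if $H\neq\{0\}$ and $p$ is a Borel probability measure on $[0,1]$ such that $L(A,B)=\int_{[0,1]}A!_tB\,dp(t)$ for all positive invertible operators $A,B$ on $H$, then $p=\mu$. -/

import Mathlib

open MeasureTheory Filter Topology

noncomputable section

namespace LogMean

section Operators

variable {𝕜 : Type*} [RCLike 𝕜] {H : Type*} [NormedAddCommGroup H] [InnerProductSpace 𝕜 H]

/-- A positive invertible operator: self-adjoint (symmetric), `0 ≤ ⟪A x, x⟫`, and invertible in the
algebra of bounded operators. -/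
def IsPosInvertible (A : H →L[𝕜] H) : Prop :=
  A.IsPositive ∧ IsUnit A

/-- The real points of the spectrum of `T` (for a self-adjoint `T`, this is the whole spectrum). -/
def realSpectrum (T : H →L[𝕜] H) : Set ℝ :=
  {x : ℝ | (x : 𝕜) ∈ spectrum 𝕜 T}

/-- The value `p(T)` of a polynomial with real coefficients at a bounded operator. -/
def polyEval (p : Polynomial ℝ) (T : H →L[𝕜] H) : H →L[𝕜] H :=
  Polynomial.aeval T (p.map (algebraMap ℝ 𝕜))

/-- `X = f(T)` in the sense of the continuous functional calculus of a self-adjoint operator `T`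
on a real or complex Hilbert space: `pₙ(T) → X` in operator norm whenever the real polynomials `pₙ`
converge to `f` uniformly on the spectrum of `T`. -/
def IsFunctionalValue (f : ℝ → ℝ) (T X : H →L[𝕜] H) : Prop :=
  ∀ p : ℕ → Polynomial ℝ,
    TendstoUniformlyOn (fun n x => (p n).eval x) f atTop (realSpectrum T) →
      Tendsto (fun n => polyEval (p n) T) atTop (𝓝 X)

open Classical in
/-- The operator `f(T)` of the continuous functional calculus, for `T` self-adjoint and `f`
continuous on the spectrum of `T` (junk value `0` if there is no such operator). -/
def opFun (f : ℝ → ℝ) (T : H →L[𝕜] H) : H →L[𝕜] H :=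
  if h : ∃ X : H →L[𝕜] H, IsFunctionalValue f T X then h.choose else 0

/-- The real power `T ^ r` of a positive invertible operator. -/
def opPow (T : H →L[𝕜] H) (r : ℝ) : H →L[𝕜] H :=
  opFun (fun x => x ^ r) T

/-- `A ^ (-1/2) B A ^ (-1/2)`. -/
def opRatio (A B : H →L[𝕜] H) : H →L[𝕜] H :=
  opPow A (-1 / 2) * B * opPow A (-1 / 2)

/-- The weighted operator harmonic mean `A !_t B = ((1 - t) A⁻¹ + t B⁻¹)⁻¹`. -/
def harmMean (t : ℝ) (A B : H →L[𝕜] H) : H →L[𝕜] H :=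
  Ring.inverse (((1 - t : ℝ) : 𝕜) • Ring.inverse A + (t : 𝕜) • Ring.inverse B)

/-- The weighted operator geometric mean
`A ♯_t B = A ^ (1/2) (A ^ (-1/2) B A ^ (-1/2)) ^ t A ^ (1/2)`. -/
def geomMean (t : ℝ) (A B : H →L[𝕜] H) : H →L[𝕜] H :=
  opPow A (1 / 2) * opPow (opRatio A B) t * opPow A (1 / 2)

/-- The Bochner integral (in operator norm) of an operator-valued function of a real variable. -/
def opIntegral (ν : Measure ℝ) (G : ℝ → H →L[𝕜] H) : H →L[𝕜] H :=
  letI : NormedSpace ℝ (H →L[𝕜] H) := NormedSpace.restrictScalars ℝ 𝕜 (H →L[𝕜] H)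
  ∫ t, G t ∂ν

/-- The operator logarithmic mean `L(A, B) = ∫₀¹ A ♯_t B dt`. -/
def opLogMean (A B : H →L[𝕜] H) : H →L[𝕜] H :=
  opIntegral (volume.restrict (Set.Ioo 0 1)) (fun t => geomMean t A B)

end Operators

/-- `F x = (x - 1) / log x` for `x ≠ 1`, and `F 1 = 1`. -/
def logMeanFun (x : ℝ) : ℝ :=
  if x = 1 then 1 else (x - 1) / Real.log x

/-- The measure `dt / (t (1 - t) (π² + (log (t / (1 - t)))²))` on `(0, 1)`. -/
def logMeanMeasure : Measure ℝ :=
  (volume.restrict (Set.Ioo 0 1)).withDensity fun t =>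
    ENNReal.ofReal (1 / (t * (1 - t) * (Real.pi ^ 2 + Real.log (t / (1 - t)) ^ 2)))

end LogMean

end

/-! With `C = A^(-1/2) B A^(-1/2)`, both means are conjugates by `A^(1/2)` of functions of `C`: `x ^
t` for the geometric mean and `h_t(x) = x / ((1 - t) x + t)` for the harmonic one. The map `f ↦
f(C)` is bounded and linear on continuous functions on an interval containing the spectrum, so it
commutes with Bochner integrals. What remains is scalar: `∫ x ^ t dt = F(x)` and `∫ h_t(x) dμ(t) =
F(x)`.

For the second identity, `x ^ s` is the average of `h_t(x)` against the Beta(`s`, `1 - s`) density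
in `t`; this follows from the substitution that multiplies the odds `t / (1 - t)` by `x`.
Integrating over `s ∈ (0, 1)` and swapping by Tonelli turns the Beta densities into the density of
`μ` and `x ^ s` into `F(x)`. The case `x = 1` gives total mass one.

For uniqueness, the pairs `(1, x • 1)` recover the scalar transform `∫ h_t(x) dp(t)`. It determines
all moments of `p`, and moments determine a finite measure on `[0, 1]` by Weierstrass.

The functional calculus rests on `norm_polyEvalHom_le`, which bounds `‖p(T)‖` by the supremum of
`|p|` on the real spectrum. It is proved by factoring over ℝ, so real and complex scalars are
treated alike. -/

namespace LogMean

/-! ### Continuous functional calculus of a self-adjoint operator over ℝ or ℂ. -/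

section Calculus

variable {𝕜 : Type*} [RCLike 𝕜] {H : Type*} [NormedAddCommGroup H] [InnerProductSpace 𝕜 H]

/-- Evaluation of real polynomials at a bounded operator, as a ring homomorphism. -/
noncomputable def polyEvalHom (T : H →L[𝕜] H) : Polynomial ℝ →+* (H →L[𝕜] H) :=
  (Polynomial.aeval T : Polynomial 𝕜 →ₐ[𝕜] (H →L[𝕜] H)).toRingHom.comp
    (Polynomial.mapRingHom (algebraMap ℝ 𝕜))

lemma polyEval_eq_polyEvalHom (p : Polynomial ℝ) (T : H →L[𝕜] H) :
    polyEval p T = polyEvalHom T p := rfl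

lemma polyEvalHom_C (T : H →L[𝕜] H) (r : ℝ) :
    polyEvalHom T (Polynomial.C r) = (r : 𝕜) • (1 : H →L[𝕜] H) := by
  simp [polyEvalHom, Algebra.algebraMap_eq_smul_one]

lemma polyEvalHom_X (T : H →L[𝕜] H) : polyEvalHom T Polynomial.X = T := by
  simp [polyEvalHom]

lemma mem_realSpectrum_iff {T : H →L[𝕜] H} {x : ℝ} :
    x ∈ realSpectrum T ↔ ¬ IsUnit (polyEvalHom T (Polynomial.X - Polynomial.C x)) := by
  rw [map_sub, polyEvalHom_C, polyEvalHom_X, ← IsUnit.neg_iff, neg_sub]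
  simp [realSpectrum, spectrum.mem_iff, Algebra.algebraMap_eq_smul_one]

lemma isUnit_polyEvalHom_C (T : H →L[𝕜] H) {r : ℝ} (hr : r ≠ 0) :
    IsUnit (polyEvalHom T (Polynomial.C r)) :=
  ((IsUnit.mk0 r hr).map Polynomial.C).map (polyEvalHom T)

variable [CompleteSpace H]

lemma isSelfAdjoint_ofReal_smul {T : H →L[𝕜] H} (hT : IsSelfAdjoint T) (r : ℝ) :
    IsSelfAdjoint ((r : 𝕜) • T) := by
  rw [IsSelfAdjoint, star_smul, hT.star_eq]
  simp

lemma isSelfAdjoint_polyEvalHom {T : H →L[𝕜] H} (hT : IsSelfAdjoint T) (p : Polynomial ℝ) :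
    IsSelfAdjoint (polyEvalHom T p) := by
  induction p using Polynomial.induction_on' with
  | add p q hp hq => rw [map_add]; exact hp.add hq
  | monomial n a =>
    rw [← Polynomial.C_mul_X_pow_eq_monomial, map_mul, map_pow, polyEvalHom_C, polyEvalHom_X,
      smul_mul_assoc, one_mul]
    exact isSelfAdjoint_ofReal_smul (hT.pow n) a

/-- Coercivity: `⟪(S² + d) x, x⟫ = ‖S x‖² + d ‖x‖² ≥ d ‖x‖²`. -/
lemma isUnit_sq_add_smul_one {S : H →L[𝕜] H} (hS : IsSelfAdjoint S) {d : ℝ} (hd : 0 < d) :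
    IsUnit (S * S + (d : 𝕜) • (1 : H →L[𝕜] H)) := by
  refine ContinuousLinearMap.isUnit_of_forall_le_norm_inner_map _ (c := ⟨d, hd.le⟩) hd fun x => ?_
  have h : inner 𝕜 ((S * S + (d : 𝕜) • (1 : H →L[𝕜] H)) x) x
      = (((‖S x‖ ^ 2 + d * ‖x‖ ^ 2 : ℝ)) : 𝕜) := by
    have h1 : inner 𝕜 (S (S x)) x = inner 𝕜 (S x) (S x) := hS.isSymmetric (S x) x
    simp [inner_add_left, inner_smul_left, h1, inner_self_eq_norm_sq_to_K]
  rw [h, RCLike.norm_ofReal, abs_of_nonneg (by positivity)]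
  change ‖x‖ ^ 2 * d ≤ _
  nlinarith [sq_nonneg ‖S x‖]

/-- A real irreducible has degree at most two. If it has a root, it is a unit times `X - x` with `x`
off the spectrum; otherwise it is a nonzero constant times a square plus a positive constant. -/
lemma isUnit_polyEvalHom_of_irreducible {T : H →L[𝕜] H} (hT : IsSelfAdjoint T)
    {p : Polynomial ℝ} (hp : Irreducible p) (h : ∀ x ∈ realSpectrum T, p.eval x ≠ 0) :
    IsUnit (polyEvalHom T p) := by
  have h2 : p.degree ≤ 2 := hp.degree_le_two
  by_cases hroot : ∃ x, p.IsRoot x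
  · obtain ⟨x, hx⟩ := hroot
    obtain ⟨q, rfl⟩ := Polynomial.dvd_iff_isRoot.2 hx
    have hq : IsUnit q := (hp.isUnit_or_isUnit rfl).resolve_left (Polynomial.not_isUnit_X_sub_C x)
    rw [map_mul]
    refine IsUnit.mul ?_ (hq.map _)
    by_contra hn
    exact h x (mem_realSpectrum_iff.2 hn) hx
  · push Not at hroot
    obtain ⟨a, b, c, habc⟩ : ∃ a b c : ℝ, p = Polynomial.C a * Polynomial.X ^ 2 +
        Polynomial.C b * Polynomial.X + Polynomial.C c :=
      ⟨_, _, _, Polynomial.eq_quadratic_of_degree_le_two h2⟩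
    have hev : ∀ x, a * x ^ 2 + b * x + c ≠ 0 := fun x hx => hroot x (by simp [habc, hx])
    have ha : a ≠ 0 := by
      rintro rfl
      by_cases hb : b = 0
      · subst hb
        refine hp.not_isUnit ?_
        have hc : c ≠ 0 := by simpa using hev 0
        simp [habc, hc]
      · exact hev (-c / b) (by field_simp; ring)
    have hd : 0 < 4 * a * c - b ^ 2 := by
      by_contra! hd
      have hs : Real.sqrt (b ^ 2 - 4 * a * c) ^ 2 = b ^ 2 - 4 * a * c :=
        Real.sq_sqrt (by linarith)
      generalize Real.sqrt (b ^ 2 - 4 * a * c) = s at hs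
      refine hev ((-b + s) / (2 * a)) ?_
      field_simp
      linear_combination hs
    set L : Polynomial ℝ := Polynomial.C (2 * a) * Polynomial.X + Polynomial.C b with hL
    -- Completing the square: `4a p = (2aX + b)² + (4ac - b²)`.
    have hfac : p = Polynomial.C ((4 * a)⁻¹) * (L * L + Polynomial.C (4 * a * c - b ^ 2)) := by
      apply Polynomial.funext
      intro x
      simp only [habc, hL, Polynomial.eval_add, Polynomial.eval_mul, Polynomial.eval_C,
        Polynomial.eval_X, Polynomial.eval_pow]
      field_simp
      ring
    rw [hfac, map_mul, map_add, map_mul, polyEvalHom_C T (4 * a * c - b ^ 2)]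
    exact (isUnit_polyEvalHom_C T (by positivity)).mul
      (isUnit_sq_add_smul_one (isSelfAdjoint_polyEvalHom hT L) hd)

/-- A nonzero real polynomial without zeros on the spectrum gives an invertible operator. -/
lemma isUnit_polyEvalHom {T : H →L[𝕜] H} (hT : IsSelfAdjoint T) {p : Polynomial ℝ} (hp : p ≠ 0)
    (h : ∀ x ∈ realSpectrum T, p.eval x ≠ 0) : IsUnit (polyEvalHom T p) := by
  induction p using WfDvdMonoid.induction_on_irreducible with
  | zero => exact absurd rfl hp
  | unit u hu => exact hu.map _
  | mul a i ha hi ih =>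
    rw [map_mul]
    refine IsUnit.mul (isUnit_polyEvalHom_of_irreducible hT hi fun x hx h0 => ?_)
      (ih ha fun x hx h0 => ?_)
    · exact h x hx (by simp [h0])
    · exact h x hx (by simp [h0])

/-- If both `‖T‖` and `-‖T‖` were in the resolvent set, the Rayleigh quotients would be bounded by
some `c < ‖T‖`, yet for symmetric `T` their supremum is `‖T‖`. -/
lemma norm_mem_realSpectrum_or [Nontrivial H] {T : H →L[𝕜] H} (hT : IsSelfAdjoint T) :
    ‖T‖ ∈ realSpectrum T ∨ -‖T‖ ∈ realSpectrum T := by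
  suffices h : algebraMap ℝ 𝕜 ‖T‖ ∈ spectrum 𝕜 T ∨ algebraMap ℝ 𝕜 (-‖T‖) ∈ spectrum 𝕜 T from h
  simp_rw [spectrum, Set.mem_compl_iff, map_neg]
  by_contra! h
  obtain ⟨c, hc0, hc⟩ := T.abs_rayleighQuotient_le_of_norm_mem_resolventSet h.1 h.2
  have := ciSup_le hc
  rw [← T.norm_eq_iSup_rayleighQuotient hT.isSymmetric] at this
  linarith

/-- One half of spectral mapping suffices: for `|r| > c`, `p - r` has no zero on the spectrum of
`T`, so `r` is not in the spectrum of `p(T)`; but `‖p(T)‖` or its negative is. -/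
lemma norm_polyEvalHom_le {T : H →L[𝕜] H} (hT : IsSelfAdjoint T) {p : Polynomial ℝ} {c : ℝ}
    (hc : 0 ≤ c) (h : ∀ x ∈ realSpectrum T, |p.eval x| ≤ c) : ‖polyEvalHom T p‖ ≤ c := by
  rcases subsingleton_or_nontrivial H with hH | hH
  · simpa [Subsingleton.elim (polyEvalHom T p) 0] using hc
  by_contra! hlt
  -- A point of the spectrum is needed to know that `p - r` is not the zero polynomial.
  obtain ⟨y, hy⟩ : ∃ y, y ∈ realSpectrum T :=
    (norm_mem_realSpectrum_or hT).elim (fun h => ⟨_, h⟩) fun h => ⟨_, h⟩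
  have key : ∀ r : ℝ, c < |r| → r ∉ realSpectrum (polyEvalHom T p) := by
    intro r hr hmem
    rw [mem_realSpectrum_iff, map_sub, polyEvalHom_X, polyEvalHom_C, ← polyEvalHom_C T,
      ← map_sub] at hmem
    have hne : ∀ x ∈ realSpectrum T, (p - Polynomial.C r).eval x ≠ 0 := by
      intro x hx h0
      have h1 : p.eval x = r := by simpa [sub_eq_zero] using h0
      exact absurd (h x hx) (by rw [h1]; exact not_le.2 hr)
    exact hmem (isUnit_polyEvalHom hT (fun h0 => hne y hy (by simp [h0])) hne)
  rcases norm_mem_realSpectrum_or (isSelfAdjoint_polyEvalHom hT p) with h1 | h1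
  · exact key _ (by simpa using hlt) h1
  · exact key _ (by simpa using hlt) h1

/-- Two sequences approximating the same `f` differ by polynomials uniformly small on the spectrum,
so the limit along one is the limit along all. -/
lemma IsFunctionalValue.of_tendsto {T X : H →L[𝕜] H} (hT : IsSelfAdjoint T) {f : ℝ → ℝ}
    {p : ℕ → Polynomial ℝ}
    (hp : TendstoUniformlyOn (fun n x => (p n).eval x) f atTop (realSpectrum T))
    (hX : Tendsto (fun n => polyEvalHom T (p n)) atTop (𝓝 X)) : IsFunctionalValue f T X := by
  intro q hq
  have h0 : Tendsto (fun n => polyEvalHom T (q n - p n)) atTop (𝓝 0) := by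
    rw [Metric.tendsto_atTop']
    intro ε hε
    rw [Metric.tendstoUniformlyOn_iff] at hp hq
    obtain ⟨N, hN⟩ := eventually_atTop.1
      ((hp (ε / 4) (by positivity)).and (hq (ε / 4) (by positivity)))
    refine ⟨N, fun n hn => ?_⟩
    rw [dist_zero_right]
    refine (norm_polyEvalHom_le hT (c := ε / 2) (by positivity) fun x hx => ?_).trans_lt
      (by linarith)
    have h1 := (hN n hn.le).1 x hx
    have h2 := (hN n hn.le).2 x hx
    rw [Real.dist_eq, abs_lt] at h1 h2
    rw [Polynomial.eval_sub, abs_le]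
    constructor <;> linarith
  have := h0.add hX
  simpa [map_sub, polyEval_eq_polyEvalHom] using this

lemma exists_polynomial_tendstoUniformlyOn {a b : ℝ} {f : ℝ → ℝ}
    (hf : ContinuousOn f (Set.Icc a b)) {s : Set ℝ} (hs : s ⊆ Set.Icc a b) :
    ∃ p : ℕ → Polynomial ℝ, TendstoUniformlyOn (fun n x => (p n).eval x) f atTop s := by
  choose p hp using fun n : ℕ =>
    exists_polynomial_near_of_continuousOn a b f hf (1 / ((n : ℝ) + 1)) (by positivity)
  refine ⟨p, Metric.tendstoUniformlyOn_iff.2 fun ε hε => ?_⟩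
  filter_upwards [(tendsto_one_div_add_atTop_nhds_zero_nat (𝕜 := ℝ)).eventually_lt_const hε]
    with n hn x hx
  rw [dist_comm, Real.dist_eq]
  exact (hp n x (hs hx)).trans hn

lemma cauchySeq_polyEvalHom {T : H →L[𝕜] H} (hT : IsSelfAdjoint T) {f : ℝ → ℝ}
    {p : ℕ → Polynomial ℝ}
    (hp : TendstoUniformlyOn (fun n x => (p n).eval x) f atTop (realSpectrum T)) :
    CauchySeq fun n => polyEvalHom T (p n) := by
  rw [Metric.cauchySeq_iff]
  intro ε hε
  rw [Metric.tendstoUniformlyOn_iff] at hp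
  obtain ⟨N, hN⟩ := eventually_atTop.1 (hp (ε / 4) (by positivity))
  refine ⟨N, fun m hm n hn => ?_⟩
  rw [dist_eq_norm, ← map_sub]
  refine (norm_polyEvalHom_le hT (c := ε / 2) (by positivity) fun x hx => ?_).trans_lt
    (by linarith)
  have h1 := hN m hm x hx
  have h2 := hN n hn x hx
  rw [Real.dist_eq, abs_lt] at h1 h2
  rw [Polynomial.eval_sub, abs_le]
  constructor <;> linarith

variable {T : H →L[𝕜] H} {a b : ℝ} {f g : ℝ → ℝ}

lemma isFunctionalValue_opFun (hT : IsSelfAdjoint T) (hs : realSpectrum T ⊆ Set.Icc a b)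
    (hf : ContinuousOn f (Set.Icc a b)) : IsFunctionalValue f T (opFun f T) := by
  obtain ⟨p, hp⟩ := exists_polynomial_tendstoUniformlyOn hf hs
  obtain ⟨X, hX⟩ := cauchySeq_tendsto_of_complete (cauchySeq_polyEvalHom hT hp)
  have h : ∃ X : H →L[𝕜] H, IsFunctionalValue f T X := ⟨X, .of_tendsto hT hp hX⟩
  rw [opFun, dif_pos h]
  exact h.choose_spec

lemma exists_polynomial_tendsto_opFun (hT : IsSelfAdjoint T)
    (hs : realSpectrum T ⊆ Set.Icc a b) (hf : ContinuousOn f (Set.Icc a b)) :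
    ∃ p : ℕ → Polynomial ℝ,
      TendstoUniformlyOn (fun n x => (p n).eval x) f atTop (Set.Icc a b) ∧
      Tendsto (fun n => polyEvalHom T (p n)) atTop (𝓝 (opFun f T)) := by
  obtain ⟨p, hp⟩ := exists_polynomial_tendstoUniformlyOn hf subset_rfl
  exact ⟨p, hp, isFunctionalValue_opFun hT hs hf p (hp.mono hs)⟩

lemma opFun_eq_of_tendsto {X : H →L[𝕜] H} (hT : IsSelfAdjoint T)
    (hs : realSpectrum T ⊆ Set.Icc a b) (hf : ContinuousOn f (Set.Icc a b))
    {p : ℕ → Polynomial ℝ}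
    (hp : TendstoUniformlyOn (fun n x => (p n).eval x) f atTop (Set.Icc a b))
    (hX : Tendsto (fun n => polyEvalHom T (p n)) atTop (𝓝 X)) : opFun f T = X :=
  tendsto_nhds_unique (isFunctionalValue_opFun hT hs hf p (hp.mono hs)) hX

lemma opFun_congr (hT : IsSelfAdjoint T) (hs : realSpectrum T ⊆ Set.Icc a b)
    (hf : ContinuousOn f (Set.Icc a b)) (hfg : Set.EqOn f g (Set.Icc a b)) :
    opFun f T = opFun g T := by
  obtain ⟨p, hp, hp'⟩ := exists_polynomial_tendsto_opFun hT hs hf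
  exact (opFun_eq_of_tendsto hT hs (hf.congr hfg.symm) (hp.congr_right hfg) hp').symm

lemma opFun_add (hT : IsSelfAdjoint T) (hs : realSpectrum T ⊆ Set.Icc a b)
    (hf : ContinuousOn f (Set.Icc a b)) (hg : ContinuousOn g (Set.Icc a b)) :
    opFun (fun x => f x + g x) T = opFun f T + opFun g T := by
  obtain ⟨p, hp, hp'⟩ := exists_polynomial_tendsto_opFun hT hs hf
  obtain ⟨q, hq, hq'⟩ := exists_polynomial_tendsto_opFun hT hs hg
  refine opFun_eq_of_tendsto hT hs (hf.add hg) (p := fun n => p n + q n) ?_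
    (by simpa using hp'.add hq')
  simpa [Pi.add_def] using hp.add hq

lemma opFun_mul (hT : IsSelfAdjoint T) (hs : realSpectrum T ⊆ Set.Icc a b)
    (hf : ContinuousOn f (Set.Icc a b)) (hg : ContinuousOn g (Set.Icc a b)) :
    opFun (fun x => f x * g x) T = opFun f T * opFun g T := by
  obtain ⟨p, hp, hp'⟩ := exists_polynomial_tendsto_opFun hT hs hf
  obtain ⟨q, hq, hq'⟩ := exists_polynomial_tendsto_opFun hT hs hg
  refine opFun_eq_of_tendsto hT hs (hf.mul hg) (p := fun n => p n * q n) ?_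
    (by simpa using hp'.mul hq')
  obtain ⟨M, hM⟩ := isCompact_Icc.exists_bound_of_continuousOn hf
  obtain ⟨N, hN⟩ := isCompact_Icc.exists_bound_of_continuousOn hg
  rw [Metric.tendstoUniformlyOn_iff] at hp hq ⊢
  intro ε hε
  set M' := max M 0
  set N' := max N 0
  have hM0 : 0 ≤ M' := le_max_right _ _
  have hN0 : 0 ≤ N' := le_max_right _ _
  -- The product error is at most `δ (M' + N' + 1)`, using `δ ≤ 1` for the quadratic term; the `2`
  -- makes the final inequality strict.
  set δ := min 1 (ε / (M' + N' + 2)) with hδ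
  have hδ0 : 0 < δ := by positivity
  have hδ1 : δ ≤ 1 := min_le_left _ _
  have hδ2 : δ * (M' + N' + 2) ≤ ε := by
    rw [← le_div_iff₀ (by positivity)]; exact min_le_right _ _
  filter_upwards [hp δ hδ0, hq δ hδ0] with n hpn hqn x hx
  have h1 := hpn x hx
  have h2 := hqn x hx
  have h3 : |f x| ≤ M' := (hM x hx).trans (le_max_left _ _)
  have h4 : |g x| ≤ N' := (hN x hx).trans (le_max_left _ _)
  rw [Real.dist_eq] at h1 h2 ⊢
  have h5 : f x * g x - (p n * q n).eval x
      = f x * (g x - (q n).eval x) + (f x - (p n).eval x) * g x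
        - (f x - (p n).eval x) * (g x - (q n).eval x) := by
    rw [Polynomial.eval_mul]; ring
  rw [h5]
  calc _ ≤ |f x * (g x - (q n).eval x)| + |(f x - (p n).eval x) * g x|
        + |(f x - (p n).eval x) * (g x - (q n).eval x)| :=
        (abs_sub _ _).trans (add_le_add_left (abs_add_le _ _) _)
    _ ≤ M' * δ + δ * N' + δ * 1 := by
        simp only [abs_mul]
        gcongr
        exact h2.le.trans hδ1
    _ < ε := by nlinarith

lemma opFun_const (hT : IsSelfAdjoint T) (hs : realSpectrum T ⊆ Set.Icc a b) (r : ℝ) :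
    opFun (fun _ => r) T = (r : 𝕜) • (1 : H →L[𝕜] H) := by
  refine opFun_eq_of_tendsto hT hs continuousOn_const (p := fun _ => Polynomial.C r) ?_ ?_
  · refine Metric.tendstoUniformlyOn_iff.2 fun ε hε => Eventually.of_forall fun n x _ => ?_
    simpa using hε
  · simp [polyEvalHom_C]

lemma opFun_id (hT : IsSelfAdjoint T) (hs : realSpectrum T ⊆ Set.Icc a b) :
    opFun (fun x => x) T = T := by
  refine opFun_eq_of_tendsto hT hs continuousOn_id (p := fun _ => Polynomial.X) ?_ ?_
  · refine Metric.tendstoUniformlyOn_iff.2 fun ε hε => Eventually.of_forall fun n x _ => ?_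
    simpa using hε
  · simp [polyEvalHom_X]

lemma norm_opFun_le (hT : IsSelfAdjoint T) (hs : realSpectrum T ⊆ Set.Icc a b)
    (hf : ContinuousOn f (Set.Icc a b)) {c : ℝ} (hc : 0 ≤ c)
    (h : ∀ x ∈ Set.Icc a b, |f x| ≤ c) : ‖opFun f T‖ ≤ c := by
  obtain ⟨p, hp, hp'⟩ := exists_polynomial_tendsto_opFun hT hs hf
  refine le_of_forall_pos_le_add fun ε hε => le_of_tendsto hp'.norm ?_
  filter_upwards [Metric.tendstoUniformlyOn_iff.1 hp ε hε] with n hn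
  refine norm_polyEvalHom_le hT (by positivity) fun x hx => ?_
  have h1 := hn x (hs hx)
  rw [dist_comm, Real.dist_eq] at h1
  linarith [h x (hs hx), abs_sub_abs_le_abs_sub ((p n).eval x) (f x)]

lemma isSelfAdjoint_opFun (hT : IsSelfAdjoint T) (hs : realSpectrum T ⊆ Set.Icc a b)
    (hf : ContinuousOn f (Set.Icc a b)) : IsSelfAdjoint (opFun f T) := by
  obtain ⟨p, hp, hp'⟩ := exists_polynomial_tendsto_opFun hT hs hf
  have := (continuous_star.tendsto _).comp hp'
  refine tendsto_nhds_unique this (hp'.congr fun n => ?_)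
  exact (isSelfAdjoint_polyEvalHom hT (p n)).star_eq.symm

/-- The spectrum of a positive invertible operator lies in a compact interval of positive reals. -/
lemma IsPosInvertible.realSpectrum_subset {A : H →L[𝕜] H} (hA : IsPosInvertible A) :
    ∃ a b : ℝ, 0 < a ∧ a ≤ b ∧ realSpectrum A ⊆ Set.Icc a b := by
  have hclosed : IsClosed (realSpectrum A) :=
    (spectrum.isClosed (𝕜 := 𝕜) A).preimage RCLike.continuous_ofReal
  have h0 : (0 : ℝ) ∈ (realSpectrum A)ᶜ := by
    simpa [realSpectrum, spectrum.zero_mem_iff] using hA.2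
  -- Invertibility puts `0` in the open resolvent set, which leaves a gap of width `ε` around it.
  obtain ⟨ε, hε, hball⟩ := Metric.isOpen_iff.1 hclosed.isOpen_compl 0 h0
  have hnonneg : ∀ x ∈ realSpectrum A, 0 ≤ x := by
    intro x hx
    by_contra! hneg
    rw [mem_realSpectrum_iff, map_sub, polyEvalHom_X, polyEvalHom_C] at hx
    refine hx (ContinuousLinearMap.isUnit_of_forall_le_norm_inner_map _
      (c := ⟨-x, by linarith⟩) (neg_pos.2 hneg) fun v => ?_)
    refine le_trans ?_ (RCLike.re_le_norm _)
    change ‖v‖ ^ 2 * (-x) ≤ _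
    have h1 : RCLike.re (inner 𝕜 ((A - (x : 𝕜) • (1 : H →L[𝕜] H)) v) v)
        = RCLike.re (inner 𝕜 (A v) v) - x * ‖v‖ ^ 2 := by
      rw [sub_apply, inner_sub_left, map_sub, smul_apply,
        one_apply_eq_self, inner_smul_left, RCLike.conj_ofReal,
        RCLike.re_ofReal_mul, inner_self_eq_norm_sq]
    rw [h1]
    linarith [hA.1.re_inner_nonneg_left v]
  -- The maximum with `ε` keeps the interval nonempty even when the spectrum is empty, as on the
  -- zero space.
  refine ⟨ε, max ε (‖A‖ * ‖(1 : H →L[𝕜] H)‖), hε, le_max_left _ _, fun x hx => ⟨?_, ?_⟩⟩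
  · by_contra! hlt
    refine hball ?_ hx
    rw [Metric.mem_ball, Real.dist_eq, sub_zero, abs_of_nonneg (hnonneg x hx)]
    exact hlt
  · refine le_max_of_le_right ((le_abs_self x).trans ?_)
    simpa using spectrum.norm_le_norm_mul_of_mem (𝕜 := 𝕜) (a := A) hx

end Calculus

end LogMean

namespace LogMean

/-! ### Scalar integral representations of `x ^ s` and of the logarithmic mean. -/

section Scalar

/-- The function `t ↦ x / ((1 - t) x + t)`, the weighted harmonic mean of `1` and `x`. -/
noncomputable def harmFun (t x : ℝ) : ℝ := x / ((1 - t) * x + t)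

lemma harmFun_denom_pos {t x : ℝ} (ht : t ∈ Set.Icc (0 : ℝ) 1) (hx : 0 < x) :
    0 < (1 - t) * x + t := by
  rcases ht.1.eq_or_lt with h | h
  · simpa [← h] using hx
  · have := mul_nonneg (sub_nonneg.2 ht.2) hx.le
    linarith

lemma harmFun_nonneg {t x : ℝ} (ht : t ∈ Set.Icc (0 : ℝ) 1) (hx : 0 < x) : 0 ≤ harmFun t x :=
  div_nonneg hx.le (harmFun_denom_pos ht hx).le

lemma harmFun_one (t : ℝ) : harmFun t 1 = 1 := by simp [harmFun]

/-- The density on `(0, 1)` whose harmonic average is the power `x ^ s`. -/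
noncomputable def powDensity (s t : ℝ) : ℝ :=
  Real.sin (Real.pi * s) / Real.pi * t ^ (s - 1) * (1 - t) ^ (-s)

lemma powDensity_nonneg {s t : ℝ} (hs : s ∈ Set.Icc (0 : ℝ) 1) (ht : t ∈ Set.Icc (0 : ℝ) 1) :
    0 ≤ powDensity s t := by
  have h1 : 0 ≤ Real.sin (Real.pi * s) :=
    Real.sin_nonneg_of_nonneg_of_le_pi (mul_nonneg Real.pi_pos.le hs.1)
      (mul_le_of_le_one_right Real.pi_pos.le hs.2)
  have h2 := Real.rpow_nonneg ht.1 (s - 1)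
  have h3 := Real.rpow_nonneg (sub_nonneg.2 ht.2) (-s)
  have := Real.pi_pos
  unfold powDensity
  positivity

/-- This is the Beta(`s`, `1 - s`) density: its normalising constant is `sin(πs) / π` by Euler's
reflection formula. -/
lemma lintegral_powDensity {s : ℝ} (hs : s ∈ Set.Ioo (0 : ℝ) 1) :
    ∫⁻ t in Set.Ioo (0 : ℝ) 1, ENNReal.ofReal (powDensity s t) = 1 := by
  rw [← ProbabilityTheory.lintegral_betaPDF_eq_one hs.1 (sub_pos.2 hs.2),
    ← lintegral_indicator measurableSet_Ioo]
  congr 1 with t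
  have hbeta : ProbabilityTheory.beta s (1 - s) = Real.pi / Real.sin (Real.pi * s) := by
    rw [ProbabilityTheory.beta, Real.Gamma_mul_Gamma_one_sub]
    simp
  by_cases ht : 0 < t ∧ t < 1
  · rw [Set.indicator_of_mem (show t ∈ Set.Ioo (0 : ℝ) 1 from ht), ProbabilityTheory.betaPDF,
      ProbabilityTheory.betaPDFReal, if_pos ht, hbeta, powDensity, one_div_div]
    ring_nf
  · rw [Set.indicator_of_notMem (show t ∉ Set.Ioo (0 : ℝ) 1 from ht), ProbabilityTheory.betaPDF,
      ProbabilityTheory.betaPDFReal, if_neg ht, ENNReal.ofReal_zero]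

/-- The automorphism of `(0, 1)` that multiplies `t / (1 - t)` by `x`. -/
noncomputable def oddsScale (x t : ℝ) : ℝ := x * t / ((1 - t) + x * t)

lemma oddsScale_denom_pos {x t : ℝ} (hx : 0 < x) (ht : t ∈ Set.Ioo (0 : ℝ) 1) :
    0 < (1 - t) + x * t := by
  have := mul_pos hx ht.1
  linarith [ht.2]

lemma one_sub_oddsScale {x t : ℝ} (hx : 0 < x) (ht : t ∈ Set.Ioo (0 : ℝ) 1) :
    1 - oddsScale x t = (1 - t) / ((1 - t) + x * t) := by
  have := (oddsScale_denom_pos hx ht).ne'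
  rw [oddsScale]
  field_simp
  ring

lemma oddsScale_mem {x t : ℝ} (hx : 0 < x) (ht : t ∈ Set.Ioo (0 : ℝ) 1) :
    oddsScale x t ∈ Set.Ioo (0 : ℝ) 1 := by
  refine ⟨div_pos (mul_pos hx ht.1) (oddsScale_denom_pos hx ht), sub_pos.1 ?_⟩
  rw [one_sub_oddsScale hx ht]
  exact div_pos (sub_pos.2 ht.2) (oddsScale_denom_pos hx ht)

lemma oddsScale_inv_oddsScale {x t : ℝ} (hx : 0 < x) (ht : t ∈ Set.Ioo (0 : ℝ) 1) :
    oddsScale x⁻¹ (oddsScale x t) = t := by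
  have h := (oddsScale_denom_pos hx ht).ne'
  rw [oddsScale, one_sub_oddsScale hx ht, oddsScale]
  field_simp
  ring_nf

lemma image_oddsScale {x : ℝ} (hx : 0 < x) :
    oddsScale x '' Set.Ioo (0 : ℝ) 1 = Set.Ioo (0 : ℝ) 1 := by
  refine Set.Subset.antisymm (Set.image_subset_iff.2 fun t ht => oddsScale_mem hx ht)
    fun t ht => ⟨oddsScale x⁻¹ t, oddsScale_mem (inv_pos.2 hx) ht, ?_⟩
  simpa using oddsScale_inv_oddsScale (inv_pos.2 hx) ht

lemma hasDerivAt_oddsScale {x t : ℝ} (hx : 0 < x) (ht : t ∈ Set.Ioo (0 : ℝ) 1) :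
    HasDerivAt (oddsScale x) (x / ((1 - t) + x * t) ^ 2) t := by
  have h1 : HasDerivAt (fun t : ℝ => x * t) x t := by
    simpa using (hasDerivAt_id t).const_mul x
  have h2 : HasDerivAt (fun t : ℝ => (1 - t) + x * t) (-1 + x) t :=
    ((hasDerivAt_id t).const_sub 1).add h1
  refine (h1.div h2 (oddsScale_denom_pos hx ht).ne').congr_deriv ?_
  ring

/-- With `D = (1 - t) + x t`, the harmonic factor becomes `D` and the density gains `x ^ (s - 1) *
D`; both powers of `D` cancel the Jacobian `x / D²`, leaving `x ^ s`. -/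
lemma harmFun_mul_powDensity_oddsScale {s x t : ℝ} (hx : 0 < x) (ht : t ∈ Set.Ioo (0 : ℝ) 1) :
    x / ((1 - t) + x * t) ^ 2 *
      (harmFun (oddsScale x t) x * powDensity s (oddsScale x t)) = x ^ s * powDensity s t := by
  have hD := oddsScale_denom_pos hx ht
  have h1 := sub_pos.2 ht.2
  have hh : harmFun (oddsScale x t) x = (1 - t) + x * t := by
    rw [harmFun, one_sub_oddsScale hx ht, oddsScale]
    field_simp
    ring
  rw [hh, powDensity, one_sub_oddsScale hx ht, oddsScale, powDensity]
  generalize (1 - t) + x * t = D at *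
  generalize 1 - t = r at *
  have e1 : (x * t / D) ^ (s - 1) = x ^ s / x * t ^ (s - 1) * (D * D ^ (-s)) := by
    rw [Real.div_rpow (mul_pos hx ht.1).le hD.le, Real.mul_rpow hx.le ht.1.le,
      Real.rpow_sub_one hx.ne', Real.rpow_sub_one hD.ne', Real.rpow_neg hD.le]
    field_simp
  have e2 : (r / D) ^ (-s) = r ^ (-s) / D ^ (-s) := Real.div_rpow h1.le hD.le _
  have e3 := (Real.rpow_pos_of_pos hD (-s)).ne'
  rw [e1, e2]
  field_simp

lemma lintegral_harmFun_mul_powDensity {s x : ℝ} (hs : s ∈ Set.Ioo (0 : ℝ) 1) (hx : 0 < x) :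
    ∫⁻ t in Set.Ioo (0 : ℝ) 1, ENNReal.ofReal (harmFun t x * powDensity s t)
      = ENNReal.ofReal (x ^ s) := by
  conv_lhs => rw [← image_oddsScale hx]
  rw [lintegral_image_eq_lintegral_abs_deriv_mul measurableSet_Ioo
    (fun t ht => (hasDerivAt_oddsScale hx ht).hasDerivWithinAt)
    (Set.LeftInvOn.injOn fun t ht => oddsScale_inv_oddsScale hx ht)]
  rw [setLIntegral_congr_fun (g := fun t => ENNReal.ofReal (x ^ s) * ENNReal.ofReal (powDensity s t))
    measurableSet_Ioo, lintegral_const_mul', lintegral_powDensity hs, mul_one]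
  · exact ENNReal.ofReal_ne_top
  · intro t ht
    dsimp only
    rw [abs_of_nonneg (by positivity), ← ENNReal.ofReal_mul (by positivity),
      ← ENNReal.ofReal_mul (Real.rpow_nonneg hx.le s), harmFun_mul_powDensity_oddsScale hx ht]

lemma lintegral_Ioo_eq_ofReal_sub {f F : ℝ → ℝ} (hF : ∀ s, HasDerivAt F (f s) s)
    (hf : Continuous f) (h0 : ∀ s ∈ Set.Ioo (0 : ℝ) 1, 0 ≤ f s) :
    ∫⁻ s in Set.Ioo (0 : ℝ) 1, ENNReal.ofReal (f s) = ENNReal.ofReal (F 1 - F 0) := by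
  rw [← intervalIntegral.integral_eq_sub_of_hasDerivAt (fun s _ => hF s)
    (hf.intervalIntegrable 0 1), intervalIntegral.integral_of_le zero_le_one,
    integral_Ioc_eq_integral_Ioo, ofReal_integral_eq_lintegral_ofReal]
  · exact (hf.integrableOn_Icc).mono_set Set.Ioo_subset_Icc_self
  · exact (ae_restrict_iff' measurableSet_Ioo).2 (Eventually.of_forall h0)

/-- As a function of `s` with `u = log (t / (1 - t))` fixed, the density is a multiple of `exp (u s)
sin (π s)`, which has an elementary antiderivative. -/
lemma powDensity_eq {s t : ℝ} (ht : t ∈ Set.Ioo (0 : ℝ) 1) :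
    powDensity s t = (Real.pi * t)⁻¹ *
      (Real.exp (Real.log (t / (1 - t)) * s) * Real.sin (Real.pi * s)) := by
  have h1 := sub_pos.2 ht.2
  have h2 : Real.exp (Real.log (t / (1 - t)) * s) = t ^ s * (1 - t) ^ (-s) := by
    rw [← Real.rpow_def_of_pos (div_pos ht.1 h1), Real.div_rpow ht.1.le h1.le, Real.rpow_neg h1.le]
    rfl
  rw [h2, powDensity, Real.rpow_sub_one ht.1.ne']
  have := ht.1.ne'
  field_simp

lemma lintegral_powDensity_exponent {t : ℝ} (ht : t ∈ Set.Ioo (0 : ℝ) 1) :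
    ∫⁻ s in Set.Ioo (0 : ℝ) 1, ENNReal.ofReal (powDensity s t) =
      ENNReal.ofReal (1 / (t * (1 - t) * (Real.pi ^ 2 + Real.log (t / (1 - t)) ^ 2))) := by
  have h1 := sub_pos.2 ht.2
  have hnn : ∀ s ∈ Set.Ioo (0 : ℝ) 1, 0 ≤ powDensity s t := fun s hs =>
    powDensity_nonneg (Set.Ioo_subset_Icc_self hs) (Set.Ioo_subset_Icc_self ht)
  simp_rw [powDensity_eq ht] at hnn ⊢
  have hexp : Real.exp (Real.log (t / (1 - t))) = t / (1 - t) := Real.exp_log (div_pos ht.1 h1)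
  generalize Real.log (t / (1 - t)) = u at *
  have hpi := Real.pi_pos
  have hden : 0 < Real.pi ^ 2 + u ^ 2 := by positivity
  have hderiv : ∀ s, HasDerivAt (fun s => (Real.pi * t)⁻¹ * (Real.exp (u * s) *
      (u * Real.sin (Real.pi * s) - Real.pi * Real.cos (Real.pi * s)) / (Real.pi ^ 2 + u ^ 2)))
      ((Real.pi * t)⁻¹ * (Real.exp (u * s) * Real.sin (Real.pi * s))) s := by
    intro s
    have hu : HasDerivAt (fun s : ℝ => u * s) u s := by simpa using (hasDerivAt_id s).const_mul u
    have hp : HasDerivAt (fun s : ℝ => Real.pi * s) Real.pi s := by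
      simpa using (hasDerivAt_id s).const_mul Real.pi
    refine (((hu.exp.mul ((hp.sin.const_mul u).sub (hp.cos.const_mul Real.pi))).div_const
      (Real.pi ^ 2 + u ^ 2)).const_mul (Real.pi * t)⁻¹).congr_deriv ?_
    simp only [Pi.sub_apply]
    field_simp
    ring
  rw [lintegral_Ioo_eq_ofReal_sub hderiv (by fun_prop) hnn]
  -- At the endpoints only the cosine terms survive, giving the factor `exp u + 1 = 1 / (1 - t)`.
  congr 1
  have := ht.1.ne'
  simp [hexp]
  field_simp
  ring

lemma lintegral_rpow_exponent {x : ℝ} (hx : 0 < x) :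
    ∫⁻ s in Set.Ioo (0 : ℝ) 1, ENNReal.ofReal (x ^ s) = ENNReal.ofReal (logMeanFun x) := by
  by_cases h1 : x = 1
  · simp [h1, logMeanFun]
  have hlog : Real.log x ≠ 0 := Real.log_ne_zero_of_pos_of_ne_one hx h1
  have hderiv : ∀ s : ℝ, HasDerivAt (fun s : ℝ => x ^ s / Real.log x) (x ^ s) s := by
    intro s
    refine ((Real.hasStrictDerivAt_const_rpow hx s).hasDerivAt.div_const _).congr_deriv ?_
    field_simp
  rw [lintegral_Ioo_eq_ofReal_sub hderiv (Real.continuous_const_rpow hx.ne')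
    fun s _ => Real.rpow_nonneg hx.le s]
  simp [logMeanFun, h1, sub_div]

lemma logMeanFun_nonneg {x : ℝ} (hx : 0 < x) : 0 ≤ logMeanFun x := by
  unfold logMeanFun
  split_ifs with h
  · exact zero_le_one
  · rcases le_total 1 x with h1 | h1
    · exact div_nonneg (sub_nonneg.2 h1) (Real.log_nonneg h1)
    · exact div_nonneg_of_nonpos (sub_nonpos.2 h1) (Real.log_nonpos hx.le h1)

lemma measurable_logMeanDensity : Measurable fun t : ℝ =>
    ENNReal.ofReal (1 / (t * (1 - t) * (Real.pi ^ 2 + Real.log (t / (1 - t)) ^ 2))) := by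
  fun_prop

/-- Write the density of the measure as the `s`-integral of `powDensity`, then swap by Tonelli.
Working with `∫⁻` avoids any prior integrability check. -/
lemma lintegral_harmFun_logMeanMeasure {x : ℝ} (hx : 0 < x) :
    ∫⁻ t, ENNReal.ofReal (harmFun t x) ∂logMeanMeasure = ENNReal.ofReal (logMeanFun x) := by
  have hm : Measurable fun t => harmFun t x := by unfold harmFun; fun_prop
  have hm2 : Measurable fun q : ℝ × ℝ => powDensity q.2 q.1 := by
    unfold powDensity; fun_prop
  rw [logMeanMeasure, lintegral_withDensity_eq_lintegral_mul _ measurable_logMeanDensity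
    hm.ennreal_ofReal]
  calc _ = ∫⁻ t in Set.Ioo (0 : ℝ) 1, ∫⁻ s in Set.Ioo (0 : ℝ) 1,
        ENNReal.ofReal (harmFun t x * powDensity s t) := by
        refine setLIntegral_congr_fun measurableSet_Ioo fun t ht => ?_
        have h0 := harmFun_nonneg (Set.Ioo_subset_Icc_self ht) hx
        simp_rw [Pi.mul_apply, ENNReal.ofReal_mul h0]
        rw [lintegral_const_mul' _ _ ENNReal.ofReal_ne_top, lintegral_powDensity_exponent ht,
          mul_comm]
    _ = ∫⁻ s in Set.Ioo (0 : ℝ) 1, ∫⁻ t in Set.Ioo (0 : ℝ) 1,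
        ENNReal.ofReal (harmFun t x * powDensity s t) := by
        refine lintegral_lintegral_swap (Measurable.aemeasurable ?_)
        exact ((hm.comp measurable_fst).mul hm2).ennreal_ofReal
    _ = ∫⁻ s in Set.Ioo (0 : ℝ) 1, ENNReal.ofReal (x ^ s) :=
        setLIntegral_congr_fun measurableSet_Ioo fun s hs =>
          lintegral_harmFun_mul_powDensity hs hx
    _ = _ := lintegral_rpow_exponent hx

instance isProbabilityMeasure_logMeanMeasure : IsProbabilityMeasure logMeanMeasure := by
  constructor
  simpa [harmFun_one, logMeanFun] using lintegral_harmFun_logMeanMeasure one_pos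

lemma logMeanMeasure_compl_Ioo : logMeanMeasure (Set.Ioo 0 1)ᶜ = 0 :=
  (withDensity_absolutelyContinuous _ _) (by simp [measurableSet_Ioo])

lemma ae_mem_Ioo_logMeanMeasure : ∀ᵐ t ∂logMeanMeasure, t ∈ Set.Ioo (0 : ℝ) 1 :=
  logMeanMeasure_compl_Ioo

lemma integral_harmFun_logMeanMeasure {x : ℝ} (hx : 0 < x) :
    ∫ t, harmFun t x ∂logMeanMeasure = logMeanFun x := by
  have hm : Measurable fun t => harmFun t x := by unfold harmFun; fun_prop
  rw [integral_eq_lintegral_of_nonneg_ae _ hm.aestronglyMeasurable,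
    lintegral_harmFun_logMeanMeasure hx, ENNReal.toReal_ofReal (logMeanFun_nonneg hx)]
  filter_upwards [ae_mem_Ioo_logMeanMeasure] with t ht
  exact harmFun_nonneg (Set.Ioo_subset_Icc_self ht) hx

lemma integral_rpow_exponent {x : ℝ} (hx : 0 < x) :
    ∫ s in Set.Ioo (0 : ℝ) 1, x ^ s = logMeanFun x := by
  rw [integral_eq_lintegral_of_nonneg_ae (Eventually.of_forall fun s => Real.rpow_nonneg hx.le s)
    (Real.continuous_const_rpow hx.ne').aestronglyMeasurable, lintegral_rpow_exponent hx,
    ENNReal.toReal_ofReal (logMeanFun_nonneg hx)]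

end Scalar

end LogMean

namespace LogMean

/-! ### A finite measure on `[0, 1]` is determined by its harmonic transform. -/

section Determinacy

lemma ae_mem_of_measure_compl_eq_zero {ν : Measure ℝ} {s : Set ℝ} (h : ν sᶜ = 0) :
    ∀ᵐ t ∂ν, t ∈ s := h

lemma integrable_of_continuousOn_Icc {E : Type*} [NormedAddCommGroup E] {ν : Measure ℝ}
    [IsFiniteMeasure ν] (hν : ν (Set.Icc 0 1)ᶜ = 0)
    {f : ℝ → E} (hf : ContinuousOn f (Set.Icc 0 1)) : Integrable f ν := by
  have h := hf.integrableOn_compact (μ := ν) isCompact_Icc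
  rwa [IntegrableOn,
    Measure.restrict_eq_self_of_ae_mem (ae_mem_of_measure_compl_eq_zero hν)] at h

lemma continuousOn_pow_div (k : ℕ) {y : ℝ} (hy : 0 < y) :
    ContinuousOn (fun t : ℝ => t ^ k / (1 + t * y)) (Set.Icc 0 1) := by
  refine ContinuousOn.div (by fun_prop) (by fun_prop) fun t ht => ?_
  have := mul_nonneg ht.1 hy.le
  positivity

lemma tendsto_integral_pow_div {ν : Measure ℝ} [IsFiniteMeasure ν] (hν : ν (Set.Icc 0 1)ᶜ = 0)
    (k : ℕ) : Tendsto (fun y : ℝ => ∫ t, t ^ k / (1 + t * y) ∂ν) (𝓝[>] 0)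
      (𝓝 (∫ t, t ^ k ∂ν)) := by
  refine tendsto_integral_filter_of_dominated_convergence (fun _ => 1)
    (Eventually.of_forall fun y => ?_) ?_ (integrable_const _) ?_
  · exact (by fun_prop : Measurable fun t : ℝ => t ^ k / (1 + t * y)).aestronglyMeasurable
  · filter_upwards [self_mem_nhdsWithin] with y hy
    filter_upwards [ae_mem_of_measure_compl_eq_zero hν] with t ht
    have hy' : 0 < y := hy
    have h1 := mul_nonneg ht.1 hy'.le
    have h2 := pow_nonneg ht.1 k
    rw [Real.norm_of_nonneg (by positivity), div_le_one (by positivity)]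
    linarith [pow_le_one₀ ht.1 ht.2 (n := k)]
  · refine Eventually.of_forall fun t => ?_
    have : ContinuousAt (fun y : ℝ => t ^ k / (1 + t * y)) 0 :=
      ContinuousAt.div (by fun_prop) (by fun_prop) (by simp)
    simpa using this.tendsto.mono_left nhdsWithin_le_nhds

/-- Two finite measures on `[0, 1]` with the same harmonic transform are equal. -/
lemma measure_eq_of_integral_harmFun_eq {p ν : Measure ℝ} [IsFiniteMeasure p] [IsFiniteMeasure ν]
    (hp : p (Set.Icc 0 1)ᶜ = 0) (hν : ν (Set.Icc 0 1)ᶜ = 0)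
    (h : ∀ x : ℝ, 0 < x → ∫ t, harmFun t x ∂p = ∫ t, harmFun t x ∂ν) : p = ν := by
  -- Induction on `k`: letting `y → 0⁺` yields the `k`-th moment, and `t ^ (k + 1) / (1 + t y) = (t
  -- ^ k - t ^ k / (1 + t y)) / y` then passes to `k + 1`.
  have key : ∀ k : ℕ, ∀ y : ℝ, 0 < y →
      ∫ t, t ^ k / (1 + t * y) ∂p = ∫ t, t ^ k / (1 + t * y) ∂ν := by
    intro k
    induction k with
    | zero =>
      intro y hy
      -- The choice `x = 1 / (1 + y)` turns the harmonic transform into a Stieltjes-type transform.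
      have hh : ∀ t, harmFun t (1 / (1 + y)) = t ^ 0 / (1 + t * y) := by
        intro t
        have hy1 : 1 + y ≠ 0 := by positivity
        rw [harmFun, pow_zero]
        have : (1 - t) * (1 / (1 + y)) + t = (1 + t * y) / (1 + y) := by field_simp; ring
        rw [this, div_div_div_cancel_right₀ hy1]
      simpa only [hh] using h (1 / (1 + y)) (by positivity)
    | succ k ih =>
      intro y hy
      have hmom : ∫ t, t ^ k ∂p = ∫ t, t ^ k ∂ν :=
        tendsto_nhds_unique ((tendsto_integral_pow_div hp k).congr'
          (by filter_upwards [self_mem_nhdsWithin] with z hz using ih z hz))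
          (tendsto_integral_pow_div hν k)
      have hstep : ∀ (m : Measure ℝ) [IsFiniteMeasure m], m (Set.Icc 0 1)ᶜ = 0 →
          ∫ t, t ^ (k + 1) / (1 + t * y) ∂m
            = (∫ t, t ^ k ∂m - ∫ t, t ^ k / (1 + t * y) ∂m) / y := by
        intro m _ hm
        rw [← integral_sub (integrable_of_continuousOn_Icc hm (by fun_prop))
          (integrable_of_continuousOn_Icc hm (continuousOn_pow_div k hy)), ← integral_div]
        refine integral_congr_ae ?_
        filter_upwards [ae_mem_of_measure_compl_eq_zero hm] with t ht
        have h1 := mul_nonneg ht.1 hy.le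
        have h2 : 1 + t * y ≠ 0 := by positivity
        field_simp
        ring
      rw [hstep p hp, hstep ν hν, hmom, ih y hy]
  have hmom : ∀ k : ℕ, ∫ t, t ^ k ∂p = ∫ t, t ^ k ∂ν := fun k =>
    tendsto_nhds_unique ((tendsto_integral_pow_div hp k).congr'
      (by filter_upwards [self_mem_nhdsWithin] with z hz using key k z hz))
      (tendsto_integral_pow_div hν k)
  have hpoly : ∀ q : Polynomial ℝ, ∫ t, q.eval t ∂p = ∫ t, q.eval t ∂ν := by
    intro q
    induction q using Polynomial.induction_on' with
    | add q r hq hr =>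
      simp only [Polynomial.eval_add]
      rw [integral_add (integrable_of_continuousOn_Icc hp q.continuous.continuousOn)
        (integrable_of_continuousOn_Icc hp r.continuous.continuousOn),
        integral_add (integrable_of_continuousOn_Icc hν q.continuous.continuousOn)
        (integrable_of_continuousOn_Icc hν r.continuous.continuousOn), hq, hr]
    | monomial n a =>
      simp only [Polynomial.eval_monomial]
      rw [integral_const_mul, integral_const_mul, hmom]
  refine ext_of_forall_integral_eq_of_IsFiniteMeasure fun f => ?_
  have hclose : ∀ (m : Measure ℝ) [IsFiniteMeasure m], m (Set.Icc 0 1)ᶜ = 0 →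
      ∀ (q : Polynomial ℝ) (ε : ℝ), (∀ t ∈ Set.Icc (0 : ℝ) 1, |q.eval t - f t| < ε) →
      |∫ t, q.eval t ∂m - ∫ t, f t ∂m| ≤ ε * m.real Set.univ := by
    intro m _ hm q ε hq
    rw [← integral_sub (integrable_of_continuousOn_Icc hm q.continuous.continuousOn)
      (integrable_of_continuousOn_Icc hm f.continuous.continuousOn)]
    rw [← Real.norm_eq_abs]
    refine norm_integral_le_of_norm_le_const ?_
    filter_upwards [ae_mem_of_measure_compl_eq_zero hm] with t ht using (hq t ht).le
  refine eq_of_forall_dist_le fun δ hδ => ?_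
  -- The added `1` keeps `M` positive even if both measures vanish.
  set M := p.real Set.univ + ν.real Set.univ + 1
  have hM : 0 < M := by positivity
  obtain ⟨q, hq⟩ := exists_polynomial_near_of_continuousOn 0 1 f f.continuous.continuousOn
    (δ / M) (by positivity)
  have h1 := abs_le.1 (hclose p hp q _ hq)
  have h2 := abs_le.1 (hclose ν hν q _ hq)
  rw [hpoly] at h1
  have h3 : δ / M * M = δ := div_mul_cancel₀ _ hM.ne'
  have h4 : δ / M * p.real Set.univ + δ / M * ν.real Set.univ ≤ δ := by
    rw [← mul_add]
    refine le_trans ?_ h3.le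
    gcongr
    simp [M]
  rw [Real.dist_eq, abs_le]
  constructor <;> linarith [h1.1, h1.2, h2.1, h2.2]

end Determinacy

end LogMean

namespace LogMean

/-! ### Exchanging the functional calculus with Bochner integrals. -/

section OperatorIntegral

variable {𝕜 : Type*} [RCLike 𝕜] {H : Type*} [NormedAddCommGroup H] [InnerProductSpace 𝕜 H]

lemma opIntegral_congr_ae {ν : Measure ℝ} {Y Z : ℝ → H →L[𝕜] H} (h : Y =ᵐ[ν] Z) :
    opIntegral ν Y = opIntegral ν Z := by
  let _ : NormedSpace ℝ (H →L[𝕜] H) := NormedSpace.restrictScalars ℝ 𝕜 (H →L[𝕜] H)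
  exact integral_congr_ae h

variable [CompleteSpace H]

lemma opIntegral_ofReal_smul {ν : Measure ℝ} (f : ℝ → ℝ) (X : H →L[𝕜] H) :
    opIntegral ν (fun t => (f t : 𝕜) • X) = ((∫ t, f t ∂ν : ℝ) : 𝕜) • X := by
  let _ : NormedSpace ℝ (H →L[𝕜] H) := NormedSpace.restrictScalars ℝ 𝕜 (H →L[𝕜] H)
  exact integral_smul_const f X

variable {T : H →L[𝕜] H} {a b : ℝ}

/-- The map `f ↦ R f(T) R` is linear on `C([a, b])` with norm at most `‖R‖²`, and bounded linear
maps preserve integrability and commute with the integral. -/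
lemma integrable_and_opIntegral_conj_opFun (hT : IsSelfAdjoint T) (hab : a ≤ b)
    (hs : realSpectrum T ⊆ Set.Icc a b) (R : H →L[𝕜] H) {ν : Measure ℝ}
    {G : ℝ → C(Set.Icc a b, ℝ)} (hG : Integrable G ν) :
    Integrable (fun t => R * opFun (Set.IccExtend hab (G t)) T * R) ν ∧
    opIntegral ν (fun t => R * opFun (Set.IccExtend hab (G t)) T * R) =
      R * opFun (Set.IccExtend hab (∫ t, G t ∂ν : C(Set.Icc a b, ℝ))) T * R := by
  let _ : NormedSpace ℝ (H →L[𝕜] H) := NormedSpace.restrictScalars ℝ 𝕜 (H →L[𝕜] H)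
  have hc : ∀ f : C(Set.Icc a b, ℝ), ContinuousOn (Set.IccExtend hab f) (Set.Icc a b) :=
    fun f => (f.continuous.Icc_extend').continuousOn
  let Ψ : C(Set.Icc a b, ℝ) →L[ℝ] (H →L[𝕜] H) := LinearMap.mkContinuous
    { toFun := fun f => R * opFun (Set.IccExtend hab f) T * R
      map_add' := fun f g => by
        rw [← add_mul, ← mul_add, ← opFun_add hT hs (hc f) (hc g)]
        rfl
      map_smul' := fun r f => by
        have h1 : opFun (Set.IccExtend hab ⇑(r • f)) T
            = (r : 𝕜) • opFun (Set.IccExtend hab f) T := by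
          have := opFun_mul hT hs (continuousOn_const (c := r)) (hc f)
          rw [opFun_const hT hs, smul_mul_assoc, one_mul] at this
          exact this
        rw [h1, mul_smul_comm, smul_mul_assoc]
        rfl } (‖R‖ * ‖R‖) (fun f => by
        have h1 : ‖opFun (Set.IccExtend hab f) T‖ ≤ ‖f‖ :=
          norm_opFun_le hT hs (hc f) (norm_nonneg f) fun x _ => f.norm_coe_le_norm _
        calc ‖R * opFun (Set.IccExtend hab f) T * R‖
            ≤ ‖R‖ * ‖opFun (Set.IccExtend hab f) T‖ * ‖R‖ :=
              (norm_mul_le _ _).trans (mul_le_mul_of_nonneg_right (norm_mul_le _ _) (norm_nonneg _))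
          _ ≤ ‖R‖ * ‖f‖ * ‖R‖ := by gcongr
          _ = ‖R‖ * ‖R‖ * ‖f‖ := by ring)
  exact ⟨Ψ.integrable_comp hG, Ψ.integral_comp_comm hG⟩

/-- The functional calculus commutes with integration of continuous families of functions. -/
lemma integrable_and_opIntegral_of_continuousOn (hT : IsSelfAdjoint T) (hab : a ≤ b)
    (hs : realSpectrum T ⊆ Set.Icc a b) (R : H →L[𝕜] H) {ν : Measure ℝ} [IsFiniteMeasure ν]
    (hν : ν (Set.Icc 0 1)ᶜ = 0) {K : ℝ → ℝ → ℝ}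
    (hK : ContinuousOn (Function.uncurry K) (Set.Icc 0 1 ×ˢ Set.Icc a b)) {f : ℝ → ℝ}
    (hf : ∀ x ∈ Set.Icc a b, ∫ t, K t x ∂ν = f x) {Z : ℝ → H →L[𝕜] H}
    (hZ : ∀ t ∈ Set.Icc (0 : ℝ) 1, Z t = R * opFun (K t) T * R) :
    Integrable Z ν ∧ opIntegral ν Z = R * opFun f T * R := by
  let G₀ : C(Set.Icc (0 : ℝ) 1 × Set.Icc a b, ℝ) :=
    ⟨fun q => K q.1 q.2, hK.comp_continuous
      (f := fun q : Set.Icc (0 : ℝ) 1 × Set.Icc a b => ((q.1 : ℝ), (q.2 : ℝ))) (by fun_prop)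
      fun q => ⟨q.1.2, q.2.2⟩⟩
  -- Currying the jointly continuous kernel makes `t ↦ K t` continuous for the sup norm, hence
  -- Bochner integrable.
  let G : ℝ → C(Set.Icc a b, ℝ) := fun t => G₀.curry (Set.projIcc 0 1 zero_le_one t)
  have hGc : Continuous G := G₀.curry.continuous.comp continuous_projIcc
  have hG : Integrable G ν := integrable_of_continuousOn_Icc hν hGc.continuousOn
  have hGv : ∀ t ∈ Set.Icc (0 : ℝ) 1, ∀ x (hx : x ∈ Set.Icc a b), G t ⟨x, hx⟩ = K t x := by
    intro t ht x hx
    simp only [G, Set.projIcc_of_mem zero_le_one ht]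
    rfl
  have hc : ∀ f : C(Set.Icc a b, ℝ), ContinuousOn (Set.IccExtend hab f) (Set.Icc a b) :=
    fun f => (f.continuous.Icc_extend').continuousOn
  obtain ⟨h1, h2⟩ := integrable_and_opIntegral_conj_opFun hT hab hs R hG
  have hae : (fun t => R * opFun (Set.IccExtend hab (G t)) T * R) =ᵐ[ν] Z := by
    filter_upwards [ae_mem_of_measure_compl_eq_zero hν] with t ht
    rw [hZ t ht, opFun_congr hT hs (hc (G t))]
    intro x hx
    rw [Set.IccExtend_of_mem hab _ hx, hGv t ht]
  refine ⟨h1.congr hae, ?_⟩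
  rw [← opIntegral_congr_ae hae, h2, opFun_congr hT hs (hc _)]
  intro x hx
  rw [Set.IccExtend_of_mem hab _ hx, ← hf x hx]
  -- Evaluation at `x` is bounded and linear, so the `C([a, b])`-valued integral is computed
  -- pointwise.
  have h3 := (ContinuousMap.evalCLM ℝ (⟨x, hx⟩ : Set.Icc a b)).integral_comp_comm hG
  refine h3.symm.trans (integral_congr_ae ?_)
  filter_upwards [ae_mem_of_measure_compl_eq_zero hν] with t ht
  exact hGv t ht x hx

end OperatorIntegral

/-! ### Reduction of the operator means to functions of `A^(-1/2) B A^(-1/2)`. -/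

section Means

variable {𝕜 : Type*} [RCLike 𝕜] {H : Type*} [NormedAddCommGroup H] [InnerProductSpace 𝕜 H]

lemma ringInverse_eq {M : Type*} [Ring M] {X Y : M} (h1 : X * Y = 1) (h2 : Y * X = 1) :
    Ring.inverse X = Y :=
  Ring.inverse_unit ⟨X, Y, h1, h2⟩

lemma ringInverse_conj {M : Type*} [Ring M] {R S X Y : M} (hRS : R * S = 1) (hSR : S * R = 1)
    (hXY : X * Y = 1) (hYX : Y * X = 1) : Ring.inverse (R * X * R) = S * Y * S := by
  apply ringInverse_eq
  · rw [show R * X * R * (S * Y * S) = R * (X * ((R * S) * Y)) * S by simp only [mul_assoc], hRS,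
      one_mul, hXY, mul_one, hRS]
  · rw [show S * Y * S * (R * X * R) = S * (Y * ((S * R) * X)) * R by simp only [mul_assoc], hSR,
      one_mul, hYX, mul_one, hSR]

lemma harmMean_one_ofReal_smul_one {t x : ℝ} (ht : t ∈ Set.Icc (0 : ℝ) 1) (hx : 0 < x) :
    harmMean t (1 : H →L[𝕜] H) ((x : 𝕜) • 1) = (harmFun t x : 𝕜) • 1 := by
  have hsmul : ∀ r : ℝ, r ≠ 0 →
      Ring.inverse ((r : 𝕜) • (1 : H →L[𝕜] H)) = ((r⁻¹ : ℝ) : 𝕜) • 1 := by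
    intro r hr
    apply ringInverse_eq <;>
      simp [smul_smul, hr]
  have hd := harmFun_denom_pos ht hx
  have hr : (1 - t) + t * x⁻¹ = ((1 - t) * x + t) / x := by field_simp
  rw [harmMean, Ring.inverse_one, hsmul x hx.ne', smul_smul, ← RCLike.ofReal_mul, ← add_smul,
    ← RCLike.ofReal_add, hsmul _ (by rw [hr]; positivity), hr, inv_div, harmFun]

lemma isPosInvertible_ofReal_smul_one {x : ℝ} (hx : 0 < x) :
    IsPosInvertible ((x : 𝕜) • (1 : H →L[𝕜] H)) :=
  ⟨ContinuousLinearMap.isPositive_one.smul_of_nonneg (by exact_mod_cast hx.le),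
    polyEvalHom_C (1 : H →L[𝕜] H) x ▸ isUnit_polyEvalHom_C 1 hx.ne'⟩

variable [CompleteSpace H] {A B : H →L[𝕜] H}

lemma continuousOn_rpow_Icc {a b : ℝ} (ha : 0 < a) (r : ℝ) :
    ContinuousOn (fun x : ℝ => x ^ r) (Set.Icc a b) :=
  fun x hx => (Real.continuousAt_rpow_const x r (Or.inl (ha.trans_le hx.1).ne')).continuousWithinAt

lemma opPow_mul_opPow (hA : IsPosInvertible A) (r s : ℝ) :
    opPow A r * opPow A s = opPow A (r + s) := by
  obtain ⟨a, b, ha, hab, hs⟩ := hA.realSpectrum_subset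
  have hT := hA.1.isSelfAdjoint
  rw [opPow, opPow, ← opFun_mul hT hs (continuousOn_rpow_Icc ha r) (continuousOn_rpow_Icc ha s)]
  refine opFun_congr hT hs ((continuousOn_rpow_Icc ha r).mul (continuousOn_rpow_Icc ha s))
    fun x hx => ?_
  exact (Real.rpow_add (ha.trans_le hx.1) r s).symm

lemma opPow_zero (hA : IsPosInvertible A) : opPow A 0 = 1 := by
  obtain ⟨a, b, ha, hab, hs⟩ := hA.realSpectrum_subset
  have := opFun_const hA.1.isSelfAdjoint hs 1
  simpa [opPow] using this

lemma opPow_one (hA : IsPosInvertible A) : opPow A 1 = A := by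
  obtain ⟨a, b, ha, hab, hs⟩ := hA.realSpectrum_subset
  have := opFun_id hA.1.isSelfAdjoint hs
  simpa [opPow] using this

lemma isSelfAdjoint_opPow (hA : IsPosInvertible A) (r : ℝ) : IsSelfAdjoint (opPow A r) := by
  obtain ⟨a, b, ha, hab, hs⟩ := hA.realSpectrum_subset
  exact isSelfAdjoint_opFun hA.1.isSelfAdjoint hs (continuousOn_rpow_Icc ha r)

lemma opPow_half_mul_opPow_neg_half (hA : IsPosInvertible A) :
    opPow A (1 / 2) * opPow A (-1 / 2) = 1 := by
  rw [opPow_mul_opPow hA, show (1 / 2 : ℝ) + -1 / 2 = 0 by norm_num, opPow_zero hA]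

lemma opPow_neg_half_mul_opPow_half (hA : IsPosInvertible A) :
    opPow A (-1 / 2) * opPow A (1 / 2) = 1 := by
  rw [opPow_mul_opPow hA, show (-1 / 2 : ℝ) + 1 / 2 = 0 by norm_num, opPow_zero hA]

lemma opPow_half_mul_opPow_half (hA : IsPosInvertible A) :
    opPow A (1 / 2) * opPow A (1 / 2) = A := by
  rw [opPow_mul_opPow hA, show (1 / 2 : ℝ) + 1 / 2 = 1 by norm_num, opPow_one hA]

lemma isPosInvertible_opRatio (hA : IsPosInvertible A) (hB : IsPosInvertible B) :
    IsPosInvertible (opRatio A B) := by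
  have hu : IsUnit (opPow A (-1 / 2)) :=
    ⟨⟨_, _, opPow_neg_half_mul_opPow_half hA, opPow_half_mul_opPow_neg_half hA⟩, rfl⟩
  refine ⟨?_, (hu.mul hB.2).mul hu⟩
  have h := hB.1.conj_adjoint (opPow A (-1 / 2))
  rw [(isSelfAdjoint_opPow hA (-1 / 2)).adjoint_eq] at h
  exact h

lemma opPow_half_mul_opRatio_mul_opPow_half (hA : IsPosInvertible A) :
    opPow A (1 / 2) * opRatio A B * opPow A (1 / 2) = B := by
  rw [opRatio, show opPow A (1 / 2) * (opPow A (-1 / 2) * B * opPow A (-1 / 2)) * opPow A (1 / 2)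
    = (opPow A (1 / 2) * opPow A (-1 / 2)) * B * (opPow A (-1 / 2) * opPow A (1 / 2)) by
    simp only [mul_assoc], opPow_half_mul_opPow_neg_half hA, opPow_neg_half_mul_opPow_half hA,
    one_mul, mul_one]

lemma continuousOn_harmFun {a b t : ℝ} (ha : 0 < a) (ht : t ∈ Set.Icc (0 : ℝ) 1) :
    ContinuousOn (harmFun t) (Set.Icc a b) := by
  refine ContinuousOn.div (by fun_prop) (by fun_prop) fun x hx => ?_
  exact (harmFun_denom_pos ht (ha.trans_le hx.1)).ne'

/-- With `C = opRatio A B`, `(1 - t) A⁻¹ + t B⁻¹ = A^(-1/2) ((1 - t) + t C⁻¹) A^(-1/2)`, and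
`harmFun t` is the reciprocal of `(1 - t) + t x⁻¹`. -/
lemma harmMean_eq_conj_opFun (hA : IsPosInvertible A) (hB : IsPosInvertible B) {t : ℝ}
    (ht : t ∈ Set.Icc (0 : ℝ) 1) :
    harmMean t A B = opPow A (1 / 2) * opFun (harmFun t) (opRatio A B) * opPow A (1 / 2) := by
  have hC := isPosInvertible_opRatio hA hB
  obtain ⟨a, b, ha, hab, hs⟩ := hC.realSpectrum_subset
  have hT := hC.1.isSelfAdjoint
  have hRS := opPow_half_mul_opPow_neg_half hA
  have hSR := opPow_neg_half_mul_opPow_half hA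
  have hAinv : Ring.inverse A = opPow A (-1 / 2) * 1 * opPow A (-1 / 2) := by
    rw [← ringInverse_conj hRS hSR (mul_one 1) (mul_one 1), mul_one, opPow_half_mul_opPow_half hA]
  have hinv : ContinuousOn (fun x : ℝ => x⁻¹) (Set.Icc a b) :=
    continuousOn_inv₀.mono fun x hx => (ha.trans_le hx.1).ne'
  have hone : opFun (fun _ => (1 : ℝ)) (opRatio A B) = 1 := by simp [opFun_const hT hs]
  have hprod : ∀ f g : ℝ → ℝ, ContinuousOn f (Set.Icc a b) → ContinuousOn g (Set.Icc a b) →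
      (∀ x ∈ Set.Icc a b, f x * g x = 1) →
      opFun f (opRatio A B) * opFun g (opRatio A B) = 1 := by
    intro f g hf hg hfg
    rw [← opFun_mul hT hs hf hg, ← hone]
    exact opFun_congr hT hs (hf.mul hg) hfg
  have hBinv : Ring.inverse B = opPow A (-1 / 2) * opFun (fun x => x⁻¹) (opRatio A B) *
      opPow A (-1 / 2) := by
    conv_lhs => rw [← opPow_half_mul_opRatio_mul_opPow_half (B := B) hA]
    have hid := opFun_id hT hs
    refine ringInverse_conj hRS hSR ?_ ?_
    · nth_rewrite 1 [← hid]
      exact hprod _ _ continuousOn_id hinv fun x hx => mul_inv_cancel₀ (ha.trans_le hx.1).ne'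
    · nth_rewrite 2 [← hid]
      exact hprod _ _ hinv continuousOn_id fun x hx => inv_mul_cancel₀ (ha.trans_le hx.1).ne'
  have hden : ContinuousOn (fun x : ℝ => (1 - t) + t * x⁻¹) (Set.Icc a b) :=
    continuousOn_const.add (continuousOn_const.mul hinv)
  have hM : opFun (fun x : ℝ => (1 - t) + t * x⁻¹) (opRatio A B)
      = ((1 - t : ℝ) : 𝕜) • 1 + (t : 𝕜) • opFun (fun x => x⁻¹) (opRatio A B) := by
    rw [opFun_add hT hs (f := fun _ => 1 - t) (g := fun x => t * x⁻¹) continuousOn_const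
      (continuousOn_const.mul hinv), opFun_const hT hs,
      opFun_mul hT hs (f := fun _ => t) continuousOn_const hinv, opFun_const hT hs,
      smul_mul_assoc, one_mul]
  have hval : ∀ x ∈ Set.Icc a b, ((1 - t) + t * x⁻¹) * harmFun t x = 1 := by
    intro x hx
    have hx0 := ha.trans_le hx.1
    have := (harmFun_denom_pos ht hx0).ne'
    rw [harmFun]
    field_simp
  rw [harmMean, hAinv, hBinv,
    ← ringInverse_conj hSR hRS (hprod _ _ hden (continuousOn_harmFun ha ht) hval)
      (hprod _ _ (continuousOn_harmFun ha ht) hden fun x hx => by rw [mul_comm, hval x hx]), hM,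
    mul_add, add_mul]
  simp only [mul_smul_comm, smul_mul_assoc]

lemma integrable_geomMean_and_opLogMean_eq (hA : IsPosInvertible A) (hB : IsPosInvertible B) :
    IntegrableOn (fun t => geomMean t A B) (Set.Ioo 0 1) ∧
    opLogMean A B =
      opPow A (1 / 2) * opFun logMeanFun (opRatio A B) * opPow A (1 / 2) := by
  have hC := isPosInvertible_opRatio hA hB
  obtain ⟨a, b, ha, hab, hs⟩ := hC.realSpectrum_subset
  refine integrable_and_opIntegral_of_continuousOn hC.1.isSelfAdjoint hab hs
    (opPow A (1 / 2)) (K := fun t x => x ^ t) ?_ ?_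
    (fun x hx => integral_rpow_exponent (ha.trans_le hx.1)) (fun t _ => rfl)
  · rw [Measure.restrict_apply measurableSet_Icc.compl]
    exact measure_mono_null (fun t ht => ht.1 (Set.Ioo_subset_Icc_self ht.2)) measure_empty
  · refine ContinuousOn.rpow (by fun_prop) (by fun_prop) fun q hq => Or.inl ?_
    exact (ha.trans_le hq.2.1).ne'

lemma integrable_harmMean_and_opIntegral_eq (hA : IsPosInvertible A) (hB : IsPosInvertible B)
    {ν : Measure ℝ} [IsFiniteMeasure ν] (hν : ν (Set.Icc 0 1)ᶜ = 0) {f : ℝ → ℝ}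
    (hf : ∀ x, 0 < x → ∫ t, harmFun t x ∂ν = f x) :
    Integrable (fun t => harmMean t A B) ν ∧
    opIntegral ν (fun t => harmMean t A B) =
      opPow A (1 / 2) * opFun f (opRatio A B) * opPow A (1 / 2) := by
  have hC := isPosInvertible_opRatio hA hB
  obtain ⟨a, b, ha, hab, hs⟩ := hC.realSpectrum_subset
  refine integrable_and_opIntegral_of_continuousOn hC.1.isSelfAdjoint hab hs
    (opPow A (1 / 2)) (K := harmFun) hν ?_
    (fun x hx => hf x (ha.trans_le hx.1)) (fun t ht => harmMean_eq_conj_opFun hA hB ht)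
  refine ContinuousOn.div (by fun_prop) (by fun_prop) fun q hq => ?_
  exact (harmFun_denom_pos hq.1 (ha.trans_le hq.2.1)).ne'

lemma opIntegral_harmMean_one {ν : Measure ℝ} (hν : ν (Set.Icc 0 1)ᶜ = 0) {x : ℝ} (hx : 0 < x) :
    opIntegral ν (fun t => harmMean t (1 : H →L[𝕜] H) ((x : 𝕜) • 1))
      = ((∫ t, harmFun t x ∂ν : ℝ) : 𝕜) • 1 := by
  rw [← opIntegral_ofReal_smul]
  refine opIntegral_congr_ae ?_
  filter_upwards [ae_mem_of_measure_compl_eq_zero hν] with t ht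
  exact harmMean_one_ofReal_smul_one ht hx

end Means

lemma logMeanMeasure_compl_Icc : logMeanMeasure (Set.Icc 0 1)ᶜ = 0 :=
  measure_mono_null (Set.compl_subset_compl.2 Set.Ioo_subset_Icc_self) logMeanMeasure_compl_Ioo

end LogMean

theorem mainTheorem9 {𝕜 : Type*} [RCLike 𝕜] {H : Type*} [NormedAddCommGroup H]
    [InnerProductSpace 𝕜 H] [CompleteSpace H] :
    -- the measure is a probability measure on `(0, 1)`
    (IsProbabilityMeasure LogMean.logMeanMeasure ∧
      LogMean.logMeanMeasure (Set.Ioo 0 1)ᶜ = 0) ∧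
    -- the logarithmic mean is well defined, has its closed form, and is the harmonic integral
    (∀ A B : H →L[𝕜] H, LogMean.IsPosInvertible A → LogMean.IsPosInvertible B →
      IntegrableOn (fun t => LogMean.geomMean t A B) (Set.Ioo 0 1) ∧
      LogMean.opLogMean A B =
        LogMean.opPow A (1 / 2) * LogMean.opFun LogMean.logMeanFun (LogMean.opRatio A B) *
          LogMean.opPow A (1 / 2) ∧
      Integrable (fun t => LogMean.harmMean t A B) LogMean.logMeanMeasure ∧
      LogMean.opLogMean A B =
        LogMean.opIntegral LogMean.logMeanMeasure (fun t => LogMean.harmMean t A B)) ∧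
    -- it is the only representing probability measure of the logarithmic mean
    (Nontrivial H → ∀ p : Measure ℝ, IsProbabilityMeasure p → p (Set.Icc 0 1)ᶜ = 0 →
      (∀ A B : H →L[𝕜] H, LogMean.IsPosInvertible A → LogMean.IsPosInvertible B →
        LogMean.opLogMean A B = LogMean.opIntegral p (fun t => LogMean.harmMean t A B)) →
      p = LogMean.logMeanMeasure) := by
  have h2 : ∀ A B : H →L[𝕜] H, LogMean.IsPosInvertible A → LogMean.IsPosInvertible B →
      IntegrableOn (fun t => LogMean.geomMean t A B) (Set.Ioo 0 1) ∧
      LogMean.opLogMean A B =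
        LogMean.opPow A (1 / 2) * LogMean.opFun LogMean.logMeanFun (LogMean.opRatio A B) *
          LogMean.opPow A (1 / 2) ∧
      Integrable (fun t => LogMean.harmMean t A B) LogMean.logMeanMeasure ∧
      LogMean.opLogMean A B =
        LogMean.opIntegral LogMean.logMeanMeasure (fun t => LogMean.harmMean t A B) := by
    intro A B hA hB
    obtain ⟨hg, hL⟩ := LogMean.integrable_geomMean_and_opLogMean_eq hA hB
    obtain ⟨hh, hI⟩ := LogMean.integrable_harmMean_and_opIntegral_eq hA hB
      LogMean.logMeanMeasure_compl_Icc fun x hx => LogMean.integral_harmFun_logMeanMeasure hx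
    exact ⟨hg, hL, hh, hL.trans hI.symm⟩
  refine ⟨⟨LogMean.isProbabilityMeasure_logMeanMeasure, LogMean.logMeanMeasure_compl_Ioo⟩, h2, ?_⟩
  intro hH p hp hp01 h
  refine LogMean.measure_eq_of_integral_harmFun_eq hp01 LogMean.logMeanMeasure_compl_Icc
    fun x hx => ?_
  -- Testing on `A = 1`, `B = x • 1` reduces the operator identity to equality of the scalar
  -- transforms.
  have hone : LogMean.IsPosInvertible (1 : H →L[𝕜] H) := by
    simpa using LogMean.isPosInvertible_ofReal_smul_one (𝕜 := 𝕜) (H := H) one_pos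
  have hx1 := LogMean.isPosInvertible_ofReal_smul_one (𝕜 := 𝕜) (H := H) hx
  have heq := (h 1 _ hone hx1).symm.trans (h2 1 _ hone hx1).2.2.2
  rw [LogMean.opIntegral_harmMean_one hp01 hx,
    LogMean.opIntegral_harmMean_one LogMean.logMeanMeasure_compl_Icc hx] at heq
  -- The scalars can be read off because the identity is nonzero on a nontrivial space.
  exact RCLike.ofReal_injective (smul_left_injective 𝕜 (one_ne_zero (α := H →L[𝕜] H)) heq)
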